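/- For $n\ge 1$ let $\mathcal D_n$ be the set of Dyck paths of length $2n$, i.e. of strings $x\in\{+1,-1\}^{2n}$ with $\sum_{k=1}^{2n}x_k=0$ and $\sum_{k=1}^{i}x_k\ge 0$ for all $1\le i\le 2n$. The random transposition walk on $\mathcal D_n$ is the discrete-time Markov chain that, from $x\in\mathcal D_n$, chooses two positions $i,j\in\{1,\dots,2n\}$ independently and uniformly at random, exchanges $x_i$ and $x_j$ if the resulting string is again in $\mathcal D_n$, and otherwise stays at $x$. Let $P_n$ be its transition matrix, and let $\pi_n$ be the uniform distribution on $\mathcal D_n$. For $\varepsilon>0$ let $\tau_2(n,\varepsilon)$ be the least $T$ such that $$\Big(\sum_{y\in\mathcal D_n}\pi_n(y)\Big(\frac{P_n^t(x,y)}{\pi_n(y)}-1\Big)^2\Big)^{1/2}\le\varepsilon\qquad\text{for all } t\ge T \text{ and all } x\in\mathcal D_n,$$ and let $\tau_{TV}(n,\varepsilon)$ be the least $T$ such that $\frac12\sum_{y\in\mathcal D_n}|P_n^t(x,y)-\pi_n(y)|\le\varepsilon$ for all $t\ge T$ and all $x\in\mathcal D_n$. (Either is $+\infty$ if there is no such $T$.)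 Then the walk mixes in $O(n^2\log n)$ steps, in $L_2$ and in total variation: for every $\varepsilon>0$ there is a constant $C=C(\varepsilon)>0$ such that for all $n\ge 1$ $$\tau_2(n,\varepsilon)\le C\,n^2\log n\qquad\text{and}\qquad \tau_{TV}(n,\varepsilon)\le C\,n^2\log n .$$ -/

import Mathlib

/-- The height of the lattice path with steps `x` after its first `k` steps. -/
def pathHeight {m : ℕ} (x : Fin m → ℤˣ) (k : ℕ) : ℤ :=
  ∑ i : Fin m with i.val < k, (x i : ℤ)

/-- A string of `2n` steps `±1` is a Dyck path if it ends at height `0` and never goes below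
height `0`. -/
def IsDyckPath (n : ℕ) (x : Fin (2 * n) → ℤˣ) : Prop :=
  pathHeight x (2 * n) = 0 ∧ ∀ k ∈ Finset.range (2 * n + 1), 0 ≤ pathHeight x k

instance (n : ℕ) : DecidablePred (IsDyckPath n) := fun x => by
  unfold IsDyckPath; infer_instance

/-- The set of Dyck paths of length `2n`. -/
abbrev DyckPath (n : ℕ) : Type := {x : Fin (2 * n) → ℤˣ // IsDyckPath n x}

/-- One move of the walk: exchange the steps at positions `i` and `j` if the result is a Dyck path;
otherwise reject the move and stay. -/
def dyckMove {n : ℕ} (x : DyckPath n) (i j : Fin (2 * n)) : DyckPath n :=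
  if h : IsDyckPath n (fun k => x.1 (Equiv.swap i j k)) then ⟨_, h⟩ else x

/-- The transition matrix of the random transposition walk on Dyck paths of length `2n`: the two
positions are chosen independently and uniformly among the `2n` positions. -/
noncomputable def dyckWalk (n : ℕ) : Matrix (DyckPath n) (DyckPath n) ℝ :=
  fun x y => (Finset.card {p : Fin (2 * n) × Fin (2 * n) | dyckMove x p.1 p.2 = y} : ℝ) /
    (2 * n : ℝ) ^ 2

/-- The uniform distribution on a finite set. -/
noncomputable def uniformDist (Ω : Type) [Fintype Ω] : Ω → ℝ := fun _ => 1 / (Fintype.card Ω : ℝ)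

/-- The `L₂(π)` distance `‖μ/π - 1‖` of a distribution `μ` from the (positive) distribution `π`. -/
noncomputable def l2Dist {Ω : Type} [Fintype Ω] (μ π : Ω → ℝ) : ℝ :=
  √(∑ y, π y * (μ y / π y - 1) ^ 2)

/-- The total variation distance of two distributions on a finite set. -/
noncomputable def tvDist {Ω : Type} [Fintype Ω] (μ π : Ω → ℝ) : ℝ :=
  (1 / 2) * ∑ y, |μ y - π y|

/-- The mixing time of the chain with transition matrix `P`, with respect to the distance `d`, the
target distribution `π` and the accuracy `ε`: the least time from which on the law of the
chain is within `ε` of `π`, whatever the initial state. It is `⊤` if there is no such time. -/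
noncomputable def mixingTime {Ω : Type} [Fintype Ω] [DecidableEq Ω]
    (d : (Ω → ℝ) → (Ω → ℝ) → ℝ) (P : Matrix Ω Ω ℝ) (π : Ω → ℝ) (ε : ℝ) : ℕ∞ :=
  ⨅ T ∈ {T : ℕ | ∀ t, T ≤ t → ∀ x, d ((P ^ t) x) π ≤ ε}, (T : ℕ∞)

/-! The core is a logarithmic Sobolev inequality whose constant, in the unnormalised form
`entropy_le_swapEnergy`, does not depend on the length. It holds for nonnegative paths from any
height `a` down to `0`, by induction on the length after conditioning on the first step. The entropy
of `f ^ 2` splits into the entropies of the two branches and the entropy of a two-point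
distribution. The branch terms are paid for by swaps among later positions, the two-point term by
swaps involving the first position. These swaps are disjoint, so the constant does not grow.

For the two-point term, let `A` and `B` be the mean squares on the branches. The entropy is at most
a multiple of `(A - B) ^ 2 / (A + B)` (`two_point_entropy_le`). Uniform paths from heights `b + 1`
and `b - 1` can be coupled so that they differ in exactly one step, and this bounds the same
quantity by the energy of the flips (`le_flipEnergy`). The coupling exists because path counts are
log-concave in the initial height (`numPaths_mul_le`).

For mixing, let `N` be the number of Dyck paths and `V` the sum of squares of the current law.
Exactly half of all moves exchange equal steps, so the walk is lazy and one step lowers `V` by at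
least the Dirichlet form. With the logarithmic Sobolev inequality, `log (N * V)` contracts by the
factor `1 - 1 / (80 * n ^ 2)` per step. It starts at `log N ≤ n * log 4`, so order `n ^ 2 * log n`
steps suffice. The squared `L₂` distance is `N * V - 1`, and it controls total variation. -/

theorem pathHeight_zero {m : ℕ} (x : Fin m → ℤˣ) : pathHeight x 0 = 0 := by
  simp [pathHeight]

theorem pathHeight_cons_succ {m : ℕ} (u : ℤˣ) (x : Fin m → ℤˣ) (k : ℕ) :
    pathHeight (Fin.cons u x : Fin (m + 1) → ℤˣ) (k + 1) = u + pathHeight x k := by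
  simp [pathHeight, Finset.sum_filter, Fin.sum_univ_succ]

/-- The lattice path with steps `x` leads from height `a` to height `0` and never goes below
height `0`. -/
def IsPathFrom (m : ℕ) (a : ℤ) (x : Fin m → ℤˣ) : Prop :=
  a + pathHeight x m = 0 ∧ ∀ k ∈ Finset.range (m + 1), 0 ≤ a + pathHeight x k

instance (m : ℕ) (a : ℤ) : DecidablePred (IsPathFrom m a) := fun x => by
  unfold IsPathFrom; infer_instance

/-- The lattice paths with `m` steps that lead from height `a` to height `0` and never go below
height `0`. -/
def pathsFrom (m : ℕ) (a : ℤ) : Finset (Fin m → ℤˣ) := {x | IsPathFrom m a x}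

theorem mem_pathsFrom {m : ℕ} {a : ℤ} {x : Fin m → ℤˣ} :
    x ∈ pathsFrom m a ↔
      a + pathHeight x m = 0 ∧ ∀ k ∈ Finset.range (m + 1), 0 ≤ a + pathHeight x k := by
  simp [pathsFrom, IsPathFrom]

theorem pathsFrom_zero (a : ℤ) : pathsFrom 0 a = if a = 0 then Finset.univ else ∅ := by
  ext x
  rw [mem_pathsFrom]
  by_cases h : a = 0 <;> simp [h, pathHeight_zero, eq_iff_true_of_subsingleton]

theorem pathsFrom_of_neg {m : ℕ} {a : ℤ} (ha : a < 0) : pathsFrom m a = ∅ := by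
  ext x
  rw [mem_pathsFrom]
  simp only [Finset.notMem_empty, iff_false, not_and]
  intro _ h
  have := h 0 (by simp)
  rw [pathHeight_zero] at this
  omega

theorem cons_mem_pathsFrom {m : ℕ} {a : ℤ} (ha : 0 ≤ a) (u : ℤˣ) (x : Fin m → ℤˣ) :
    (Fin.cons u x : Fin (m + 1) → ℤˣ) ∈ pathsFrom (m + 1) a ↔ x ∈ pathsFrom m (a + u) := by
  simp only [mem_pathsFrom, pathHeight_cons_succ, Finset.mem_range, add_assoc]
  refine and_congr Iff.rfl ⟨fun h k hk => ?_, fun h k hk => ?_⟩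
  · have := h (k + 1) (by omega)
    rwa [pathHeight_cons_succ] at this
  · cases k with
    | zero => rw [pathHeight_zero]; omega
    | succ k => rw [pathHeight_cons_succ]; exact h k (by omega)

theorem sum_pathsFrom_succ {m : ℕ} {a : ℤ} (ha : 0 ≤ a) {M : Type*} [AddCommMonoid M]
    (g : (Fin (m + 1) → ℤˣ) → M) :
    ∑ x ∈ pathsFrom (m + 1) a, g x =
      ∑ x ∈ pathsFrom m (a + 1), g (Fin.cons 1 x) +
        ∑ x ∈ pathsFrom m (a - 1), g (Fin.cons (-1) x) := by
  have key : ∀ (k : ℕ) (b : ℤ) (h : (Fin k → ℤˣ) → M),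
      ∑ x ∈ pathsFrom k b, h x = ∑ x, if x ∈ pathsFrom k b then h x else 0 := by
    intro k b h
    rw [← Finset.sum_filter]
    congr 1
    ext; simp
  rw [key, key, key, ← (Fin.consEquiv fun _ => ℤˣ).sum_comp, Fintype.sum_prod_type]
  have hu : (Finset.univ : Finset ℤˣ) = {1, -1} := by decide
  rw [hu, Finset.sum_pair (by decide)]
  simp only [Fin.consEquiv, Equiv.coe_fn_mk, cons_mem_pathsFrom ha, Units.val_one, Units.val_neg,
    ← sub_eq_add_neg]

/-! ### Path counts and their log-concavity -/

/-- The number of lattice paths in `pathsFrom m a`. -/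
def numPaths (m : ℕ) (a : ℤ) : ℕ := (pathsFrom m a).card

theorem numPaths_succ {m : ℕ} {a : ℤ} (ha : 0 ≤ a) :
    numPaths (m + 1) a = numPaths m (a + 1) + numPaths m (a - 1) := by
  simp only [numPaths, Finset.card_eq_sum_ones]
  exact sum_pathsFrom_succ ha _

theorem numPaths_of_neg {m : ℕ} {a : ℤ} (ha : a < 0) : numPaths m a = 0 := by
  simp [numPaths, pathsFrom_of_neg ha]

theorem nonneg_of_numPaths_pos {m : ℕ} {a : ℤ} (h : 0 < numPaths m a) : 0 ≤ a := by
  by_contra hc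
  rw [numPaths_of_neg (not_le.mp hc)] at h
  exact lt_irrefl _ h

theorem numPaths_zero (a : ℤ) : numPaths 0 a = if a = 0 then 1 else 0 := by
  rw [numPaths, pathsFrom_zero]
  split_ifs <;> simp

/-- The numbers of nonnegative paths are log-concave in the initial height. -/
theorem numPaths_mul_le (m : ℕ) (a : ℤ) (k : ℕ) :
    numPaths m a * numPaths m (a + 2 * k + 2) ≤ numPaths m (a + 2) * numPaths m (a + 2 * k) := by
  induction m generalizing a k with
  | zero =>
    rw [numPaths_zero, numPaths_zero]
    split_ifs <;> omega
  | succ m ih =>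
    rcases lt_or_ge a 0 with ha | ha
    · simp [numPaths_of_neg ha]
    rw [numPaths_succ ha, numPaths_succ (by omega), numPaths_succ (by omega : 0 ≤ a + 2),
      numPaths_succ (by omega : 0 ≤ a + 2 * k)]
    have h1 := ih (a + 1) k
    have h2 := ih (a - 1) k
    -- The outermost pair of heights: an equality for `k = 0`, otherwise two nested instances of the
    -- induction hypothesis chained. This is why the statement covers all gaps `k`.
    have h3 : numPaths m (a - 1) * numPaths m (a + 2 * k + 2 + 1) ≤
        numPaths m (a + 2 + 1) * numPaths m (a + 2 * k - 1) := by
      cases k with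
      | zero =>
        rw [mul_comm]
        refine le_of_eq (congrArg₂ _ (congrArg _ ?_) (congrArg _ ?_)) <;> simp
      | succ k =>
        have h4 := ih (a - 1) (k + 2)
        have h5 := ih (a + 1) k
        push_cast at h4 h5 ⊢
        ring_nf at h4 h5 ⊢
        rw [mul_comm (numPaths m (1 + a))] at h4
        nlinarith
    ring_nf at h1 h2 h3 ⊢
    nlinarith

theorem numPaths_mul_le_sq (m : ℕ) (b : ℤ) :
    numPaths m (b + 1 + 1) * numPaths m (b - 1 - 1) ≤ numPaths m b * numPaths m b := by
  have := numPaths_mul_le m (b - 2) 1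
  rw [mul_comm]
  convert this using 3 <;> push_cast <;> ring

/-! ### Energies of flips and swaps -/

/-- The sum of the squared differences between the values of `f` on paths from `b + 1` and the
values of `g` on the paths from `b - 1` that arise by turning a down-step into an up-step. -/
noncomputable def flipEnergy (m : ℕ) (b : ℤ) (f g : (Fin m → ℤˣ) → ℝ) : ℝ :=
  ∑ x ∈ pathsFrom m (b + 1), ∑ j : Fin m,
    if x j = -1 ∧ Function.update x j 1 ∈ pathsFrom m (b - 1) then
      (f x - g (Function.update x j 1)) ^ 2 else 0

theorem flipEnergy_nonneg (m : ℕ) (b : ℤ) (f g : (Fin m → ℤˣ) → ℝ) : 0 ≤ flipEnergy m b f g :=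
  Finset.sum_nonneg fun _ _ => Finset.sum_nonneg fun _ _ => by split_ifs <;> positivity

/-- A flip at a later position keeps the first step; a flip at the first position leaves a common
tail that starts at height `b`, which gives the last sum. -/
theorem flipEnergy_succ {m : ℕ} {b : ℤ} (hb : 1 ≤ b) (f g : (Fin (m + 1) → ℤˣ) → ℝ) :
    flipEnergy (m + 1) b f g =
      flipEnergy m (b + 1) (fun x => f (Fin.cons 1 x)) (fun x => g (Fin.cons 1 x)) +
      flipEnergy m (b - 1) (fun x => f (Fin.cons (-1) x)) (fun x => g (Fin.cons (-1) x)) +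
      ∑ x ∈ pathsFrom m b, (f (Fin.cons (-1) x) - g (Fin.cons 1 x)) ^ 2 := by
  have h1 : (1 : ℤˣ) ≠ -1 := by decide
  have e1 : ∀ x : Fin m → ℤˣ, ∀ j : Fin m, Function.update (Fin.cons 1 x : Fin (m + 1) → ℤˣ) j.succ 1
      = Fin.cons 1 (Function.update x j 1) := fun x j => (Fin.cons_update ..).symm
  have e2 : ∀ x : Fin m → ℤˣ, ∀ j : Fin m,
      Function.update (Fin.cons (-1) x : Fin (m + 1) → ℤˣ) j.succ 1
      = Fin.cons (-1) (Function.update x j 1) := fun x j => (Fin.cons_update ..).symm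
  rw [flipEnergy, sum_pathsFrom_succ (by omega)]
  simp only [Fin.sum_univ_succ, Fin.cons_zero, Fin.cons_succ, h1, false_and, if_false, zero_add,
    e1, e2, true_and, Fin.update_cons_zero, cons_mem_pathsFrom (by omega : 0 ≤ b - 1),
    Finset.sum_add_distrib, Units.val_one, Units.val_neg, flipEnergy, sub_add_cancel,
    add_sub_cancel_right, ← sub_eq_add_neg]
  rw [add_comm (∑ x ∈ pathsFrom m b, _), ← add_assoc]
  congr 1
  exact Finset.sum_congr rfl fun x hx => if_pos hx

/-- The sum, over the paths and the ordered pairs of positions, of the squared change of `f` under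
the exchange of the two steps, whenever this exchange is allowed. -/
noncomputable def swapEnergy (m : ℕ) (a : ℤ) (f : (Fin m → ℤˣ) → ℝ) : ℝ :=
  ∑ x ∈ pathsFrom m a, ∑ i : Fin m, ∑ j : Fin m,
    if (fun k => x (Equiv.swap i j k)) ∈ pathsFrom m a then
      (f x - f (fun k => x (Equiv.swap i j k))) ^ 2 else 0

theorem swapEnergy_nonneg (m : ℕ) (a : ℤ) (f : (Fin m → ℤˣ) → ℝ) : 0 ≤ swapEnergy m a f :=
  Finset.sum_nonneg fun _ _ => Finset.sum_nonneg fun _ _ => Finset.sum_nonneg fun _ _ => by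
    split_ifs <;> positivity

theorem cons_comp_swap_succ {m : ℕ} (u : ℤˣ) (x : Fin m → ℤˣ) (i j : Fin m) :
    (fun k => (Fin.cons u x : Fin (m + 1) → ℤˣ) (Equiv.swap i.succ j.succ k)) =
      Fin.cons u (fun k => x (Equiv.swap i j k)) := by
  funext k
  refine Fin.cases ?_ (fun k => ?_) k
  · rw [Equiv.swap_apply_of_ne_of_ne (Fin.succ_ne_zero i).symm (Fin.succ_ne_zero j).symm]
    rfl
  · simp only [Fin.cons_succ, Equiv.swap_apply_def, Fin.succ_inj]
    split_ifs <;> simp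

theorem cons_comp_swap_zero {m : ℕ} (u : ℤˣ) (x : Fin m → ℤˣ) (j : Fin m) :
    (fun k => (Fin.cons u x : Fin (m + 1) → ℤˣ) (Equiv.swap 0 j.succ k)) =
      Fin.cons (x j) (Function.update x j u) := by
  funext k
  refine Fin.cases ?_ (fun k => ?_) k
  · simp
  · simp only [Fin.cons_succ, Equiv.swap_apply_def, Fin.succ_ne_zero, if_false, Fin.succ_inj,
      Function.update_apply]
    split_ifs <;> simp

/-- Exchanging an initial up-step with a later down-step is a flip of the tail. The other ordered
pairs involving the first position are discarded. -/
theorem le_swapEnergy_succ {m : ℕ} {a : ℤ} (ha : 0 ≤ a) (f : (Fin (m + 1) → ℤˣ) → ℝ) :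
    swapEnergy m (a + 1) (fun x => f (Fin.cons 1 x)) +
      swapEnergy m (a - 1) (fun x => f (Fin.cons (-1) x)) +
      flipEnergy m a (fun x => f (Fin.cons 1 x)) (fun x => f (Fin.cons (-1) x)) ≤
        swapEnergy (m + 1) a f := by
  rw [swapEnergy, swapEnergy, swapEnergy, flipEnergy, sum_pathsFrom_succ ha, add_right_comm,
    ← Finset.sum_add_distrib]
  have aux : ∀ (p : Prop) [Decidable p] (z : ℝ), 0 ≤ if p then z ^ 2 else 0 := by
    intro p _ z
    split_ifs <;> positivity
  refine add_le_add (Finset.sum_le_sum fun x _ => ?_) (Finset.sum_le_sum fun x _ => ?_)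
  · rw [add_comm, Fin.sum_univ_succ]
    refine add_le_add ?_ (Finset.sum_le_sum fun i _ => ?_)
    · rw [Fin.sum_univ_succ]
      refine le_add_of_nonneg_of_le (aux _ _) (Finset.sum_le_sum fun j _ => ?_)
      rw [cons_comp_swap_zero]
      split_ifs with h1 h2 h2
      · rw [h1.1]
      · rw [cons_mem_pathsFrom ha, h1.1] at h2
        exact absurd h1.2 h2
      · positivity
      · exact le_rfl
    · rw [Fin.sum_univ_succ]
      refine le_add_of_nonneg_of_le (aux _ _) (Finset.sum_le_sum fun j _ => ?_)
      simp only [cons_comp_swap_succ, cons_mem_pathsFrom ha]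
      exact le_rfl
  · rw [Fin.sum_univ_succ]
    refine le_add_of_nonneg_of_le (Finset.sum_nonneg fun j _ => aux _ _)
      (Finset.sum_le_sum fun i _ => ?_)
    rw [Fin.sum_univ_succ]
    refine le_add_of_nonneg_of_le (aux _ _) (Finset.sum_le_sum fun j _ => ?_)
    simp only [cons_comp_swap_succ, cons_mem_pathsFrom ha]
    exact le_rfl

/-! ### Coupling of paths from neighbouring heights -/

/-- For fixed `r` the lower bound is linear in `u ^ 2` and `v ^ 2`, so it can be summed over a
coupling and depends only on the marginals. -/
theorem tangent_le_sub_sq (r u v : ℝ) :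
    (r - r ^ 2 / 2) * u ^ 2 + (-r - r ^ 2 / 2) * v ^ 2 ≤ (u - v) ^ 2 := by
  nlinarith [sq_nonneg ((u - v) - r * (u + v) / 2), sq_nonneg (r * (u - v))]

theorem mul_le_of_mul_le_of_nonneg {w k l X : ℝ} (hw : 0 ≤ w) (hwk : w ≤ k) (h : k * l ≤ X)
    (hX : 0 ≤ X) : w * l ≤ X := by
  rcases le_total l 0 with hl | hl
  · exact (mul_nonpos_of_nonneg_of_nonpos hw hl).trans hX
  · exact (mul_le_mul_of_nonneg_right hwk hl).trans h

/-- The one-step recursion for `le_flipEnergy`, with `n₂, n₀, n₁` the numbers of paths from the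
heights `b + 2, b, b - 2`. -/
theorem coupling_step {n₂ n₀ n₁ F₂ F₀ G₀ G₁ α β X₁ X₂ Y M : ℝ} (h₂ : 0 ≤ n₂) (h₀ : 0 < n₀)
    (h₁ : 0 ≤ n₁) (hlc : n₂ * n₁ ≤ n₀ * n₀) (hF : n₂ = 0 → F₂ = 0) (hG : n₁ = 0 → G₁ = 0)
    (hX₁ : 0 ≤ X₁) (hX₂ : 0 ≤ X₂) (hY : 0 ≤ Y)
    (e₁ : 0 < n₂ → n₂ * (α * F₂ / n₂ + β * G₀ / n₀) ≤ X₁ ∧ n₀ * (α * F₂ / n₂ + β * G₀ / n₀) ≤ X₁)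
    (e₂ : 0 < n₁ → n₀ * (α * F₀ / n₀ + β * G₁ / n₁) ≤ X₂ ∧ n₁ * (α * F₀ / n₀ + β * G₁ / n₁) ≤ X₂)
    (e₃ : α * F₀ + β * G₀ ≤ Y) (hM : M = n₂ + n₀ ∨ M = n₀ + n₁) :
    M * (α * (F₂ + F₀) / (n₂ + n₀) + β * (G₀ + G₁) / (n₀ + n₁)) ≤ X₁ + X₂ + Y := by
  have hp : 0 < n₂ + n₀ := by linarith
  have hq : 0 < n₀ + n₁ := by linarith
  have hM0 : 0 < M := by rcases hM with h | h <;> linarith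
  -- The first steps are coupled as up-up with probability `n₂ / (n₂ + n₀)`, down-down with
  -- probability `n₁ / (n₀ + n₁)`, and down-up otherwise. Log-concavity makes the last probability
  -- nonnegative.
  have hpq : n₂ / (n₂ + n₀) ≤ n₀ / (n₀ + n₁) := by
    rw [div_le_div_iff₀ hp hq]
    nlinarith
  -- The rescaled weight is at most one of the two counts, but which one depends on `M`; hence both
  -- normalisations are carried through the induction.
  have hMp : M * (n₂ / (n₂ + n₀)) ≤ n₂ ∨ M * (n₂ / (n₂ + n₀)) ≤ n₀ := by
    rcases hM with rfl | rfl
    · left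
      rw [mul_div_cancel₀ _ hp.ne']
    · right
      refine (mul_le_mul_of_nonneg_left hpq hq.le).trans ?_
      rw [mul_div_cancel₀ _ hq.ne']
  have hpq' : n₁ / (n₀ + n₁) ≤ n₀ / (n₂ + n₀) := by
    rw [div_le_div_iff₀ hq hp]
    nlinarith
  have hMq : M * (n₁ / (n₀ + n₁)) ≤ n₀ ∨ M * (n₁ / (n₀ + n₁)) ≤ n₁ := by
    rcases hM with rfl | rfl
    · left
      refine (mul_le_mul_of_nonneg_left hpq' hp.le).trans ?_
      rw [mul_div_cancel₀ _ hp.ne']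
    · right
      rw [mul_div_cancel₀ _ hq.ne']
  have t₁ : M * (n₂ / (n₂ + n₀)) * (α * F₂ / n₂ + β * G₀ / n₀) ≤ X₁ := by
    rcases h₂.eq_or_lt with h | h
    · simpa [← h] using hX₁
    · have hw : 0 ≤ M * (n₂ / (n₂ + n₀)) := by positivity
      rcases hMp with h' | h'
      · exact mul_le_of_mul_le_of_nonneg hw h' (e₁ h).1 hX₁
      · exact mul_le_of_mul_le_of_nonneg hw h' (e₁ h).2 hX₁
  have t₂ : M * (n₁ / (n₀ + n₁)) * (α * F₀ / n₀ + β * G₁ / n₁) ≤ X₂ := by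
    rcases h₁.eq_or_lt with h | h
    · simpa [← h] using hX₂
    · have hw : 0 ≤ M * (n₁ / (n₀ + n₁)) := by positivity
      rcases hMq with h' | h'
      · exact mul_le_of_mul_le_of_nonneg hw h' (e₂ h).1 hX₂
      · exact mul_le_of_mul_le_of_nonneg hw h' (e₂ h).2 hX₂
  have t₃ : M * (n₀ / (n₀ + n₁) - n₂ / (n₂ + n₀)) * ((α * F₀ + β * G₀) / n₀) ≤ Y := by
    refine mul_le_of_mul_le_of_nonneg (k := n₀) (mul_nonneg hM0.le (sub_nonneg.mpr hpq)) ?_ ?_ hY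
    · rcases hM with rfl | rfl
      · have h3 : n₀ / (n₀ + n₁) ≤ 1 := (div_le_one hq).mpr (by linarith)
        rw [mul_sub, mul_div_cancel₀ _ hp.ne']
        nlinarith
      · have h3 : 0 ≤ n₂ / (n₂ + n₀) := by positivity
        rw [mul_sub, mul_div_cancel₀ _ hq.ne']
        nlinarith
    · rwa [mul_div_cancel₀ _ h₀.ne']
  have key : M * (α * (F₂ + F₀) / (n₂ + n₀) + β * (G₀ + G₁) / (n₀ + n₁)) =
      M * (n₂ / (n₂ + n₀)) * (α * F₂ / n₂ + β * G₀ / n₀) +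
      M * (n₁ / (n₀ + n₁)) * (α * F₀ / n₀ + β * G₁ / n₁) +
      M * (n₀ / (n₀ + n₁) - n₂ / (n₂ + n₀)) * ((α * F₀ + β * G₀) / n₀) := by
    -- An empty branch contributes `0` on both sides, division by `0` being `0`.
    have c₁ : n₂ / (n₂ + n₀) * (α * F₂ / n₂) = α * F₂ / (n₂ + n₀) := by
      rcases h₂.eq_or_lt with h | h
      · simp [hF h.symm]
      · field_simp
    have c₂ : n₁ / (n₀ + n₁) * (β * G₁ / n₁) = β * G₁ / (n₀ + n₁) := by
      rcases h₁.eq_or_lt with h | h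
      · simp [hG h.symm]
      · field_simp
    rw [mul_assoc, mul_assoc, mul_assoc, mul_add (n₂ / (n₂ + n₀)), mul_add (n₁ / (n₀ + n₁)), c₁, c₂]
    field_simp
    ring
  rw [key]
  linarith

theorem sum_eq_zero_of_numPaths_eq_zero {m : ℕ} {a : ℤ} (h : (numPaths m a : ℝ) = 0)
    (f : (Fin m → ℤˣ) → ℝ) : ∑ x ∈ pathsFrom m a, f x = 0 := by
  rw [Finset.card_eq_zero.mp (show (pathsFrom m a).card = 0 by exact_mod_cast h),
    Finset.sum_empty]

/-- Paths from `b + 1` and paths from `b - 1` can be coupled, with uniform marginals, in such a way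
that coupled paths differ in one step; this is the resulting bound for linear functionals of the
second moments that are dominated by the squared difference. -/
theorem le_flipEnergy (r : ℝ) (m : ℕ) (b : ℤ) (f g : (Fin m → ℤˣ) → ℝ)
    (hp : 0 < (numPaths m (b + 1) : ℝ)) (hn : 0 < (numPaths m (b - 1) : ℝ)) (M : ℝ)
    (hM : M = numPaths m (b + 1) ∨ M = numPaths m (b - 1)) :
    M * ((r - r ^ 2 / 2) * (∑ x ∈ pathsFrom m (b + 1), f x ^ 2) / numPaths m (b + 1) +
      (-r - r ^ 2 / 2) * (∑ x ∈ pathsFrom m (b - 1), g x ^ 2) / numPaths m (b - 1)) ≤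
        flipEnergy m b f g := by
  induction m generalizing b M with
  | zero =>
    rw [numPaths_zero] at hp hn
    split_ifs at hp hn
    · omega
    all_goals simp at hp hn
  | succ m ih =>
    have hb : 0 ≤ b - 1 := nonneg_of_numPaths_pos (by exact_mod_cast hn)
    have hlc : (numPaths m (b + 1 + 1) : ℝ) * numPaths m (b - 1 - 1) ≤ numPaths m b * numPaths m b := by
      exact_mod_cast numPaths_mul_le_sq m b
    have hpe : (numPaths (m + 1) (b + 1) : ℝ) = numPaths m (b + 1 + 1) + numPaths m b := by
      rw [numPaths_succ (by omega), add_sub_cancel_right]; push_cast; rfl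
    have hne : (numPaths (m + 1) (b - 1) : ℝ) = numPaths m b + numPaths m (b - 1 - 1) := by
      rw [numPaths_succ hb, sub_add_cancel]; push_cast; rfl
    rw [hpe] at hp hM ⊢
    rw [hne] at hn hM ⊢
    have h₂ : (0 : ℝ) ≤ numPaths m (b + 1 + 1) := Nat.cast_nonneg _
    have h₁ : (0 : ℝ) ≤ numPaths m (b - 1 - 1) := Nat.cast_nonneg _
    -- If no path started at `b`, both outer counts would be positive, against log-concavity.
    have h₀ : (0 : ℝ) < numPaths m b := by
      rcases (Nat.cast_nonneg (numPaths m b) : (0 : ℝ) ≤ numPaths m b).eq_or_lt with h | h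
      · rw [← h] at hp hn hlc
        nlinarith
      · exact h
    rw [flipEnergy_succ (by omega), sum_pathsFrom_succ (by omega : 0 ≤ b + 1),
      sum_pathsFrom_succ hb, add_sub_cancel_right, sub_add_cancel]
    refine coupling_step h₂ h₀ h₁ hlc (fun h => sum_eq_zero_of_numPaths_eq_zero h _)
      (fun h => sum_eq_zero_of_numPaths_eq_zero h _) (flipEnergy_nonneg ..) (flipEnergy_nonneg ..)
      (Finset.sum_nonneg fun _ _ => sq_nonneg _) (fun h => ?_) (fun h => ?_) ?_ hM
    · have := ih (b + 1) (fun x => f (Fin.cons 1 x)) (fun x => g (Fin.cons 1 x)) h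
        (by rwa [add_sub_cancel_right])
      rw [add_sub_cancel_right] at this
      exact ⟨this _ (Or.inl rfl), this _ (Or.inr rfl)⟩
    · have := ih (b - 1) (fun x => f (Fin.cons (-1) x)) (fun x => g (Fin.cons (-1) x))
        (by rwa [sub_add_cancel]) h
      rw [sub_add_cancel] at this
      exact ⟨this _ (Or.inl rfl), this _ (Or.inr rfl)⟩
    · rw [Finset.mul_sum, Finset.mul_sum, ← Finset.sum_add_distrib]
      exact Finset.sum_le_sum fun x _ => tangent_le_sub_sq _ _ _

/-- The second moments of functions on the paths from `b + 1` and from `b - 1` differ by a multiple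
of the energy of the flips. -/
theorem sq_sub_le_flipEnergy {m : ℕ} {b : ℤ} (f g : (Fin m → ℤˣ) → ℝ) {A B : ℝ}
    (hp : 0 < (numPaths m (b + 1) : ℝ)) (hn : 0 < (numPaths m (b - 1) : ℝ)) (hAB : 0 < A + B)
    (hA : ∑ x ∈ pathsFrom m (b + 1), f x ^ 2 = numPaths m (b + 1) * A)
    (hB : ∑ x ∈ pathsFrom m (b - 1), g x ^ 2 = numPaths m (b - 1) * B) :
    max (numPaths m (b + 1) : ℝ) (numPaths m (b - 1)) * ((A - B) ^ 2 / (A + B)) ≤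
      2 * flipEnergy m b f g := by
  -- This slope maximises `r * (A - B) - r ^ 2 * (A + B) / 2`.
  have h := le_flipEnergy ((A - B) / (A + B)) m b f g hp hn _ (max_choice _ _)
  rw [hA, hB] at h
  have e : ((A - B) / (A + B) - ((A - B) / (A + B)) ^ 2 / 2) * (numPaths m (b + 1) * A) /
        numPaths m (b + 1) + (-((A - B) / (A + B)) - ((A - B) / (A + B)) ^ 2 / 2) *
        (numPaths m (b - 1) * B) / numPaths m (b - 1) = (A - B) ^ 2 / (A + B) / 2 := by
    field_simp
    ring
  rw [e] at h
  linarith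

/-! ### Two-point entropy -/

theorem sub_le_mul_log_div {x c : ℝ} (hx : 0 ≤ x) (hc : 0 < c) :
    x - c ≤ x * (Real.log x - Real.log c) := by
  rcases hx.eq_or_lt with rfl | hx
  · simp [hc.le]
  · have h := Real.log_le_sub_one_of_pos (div_pos hc hx)
    rw [Real.log_div hc.ne' hx.ne'] at h
    have h2 : x * (Real.log c - Real.log x) ≤ x * (c / x - 1) := mul_le_mul_of_nonneg_left h hx.le
    rw [mul_sub, mul_sub x (c / x), mul_div_cancel₀ _ hx.ne'] at h2
    linarith

/-- If `A ≤ 4 * B`, replacing the mean `W` by `B` in the variational formula leaves only an error on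
the lighter point, at most `s * (A - B) ^ 2 / B`. If `A > 4 * B`, the term of `B` is nonpositive,
that of `A` is at most `t * A`, and `A` is comparable to `(A - B) ^ 2 / (A + B)`. -/
theorem two_point_entropy_le_aux {s t A B : ℝ} (hs : 0 < s) (hst : s ≤ t) (hA : 0 ≤ A)
    (hB : 0 ≤ B) (hAB : 0 < A + B) :
    s * A * Real.log A + t * B * Real.log B -
      (s * A + t * B) * Real.log ((s * A + t * B) / (s + t)) ≤ 5 * t * ((A - B) ^ 2 / (A + B)) := by
  have ht : 0 < t := hs.trans_le hst
  have hN : 0 < s + t := by linarith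
  set W := (s * A + t * B) / (s + t) with hW
  have hS : s * A + t * B = (s + t) * W := by rw [hW]; field_simp
  have hW0 : 0 < W := by
    refine div_pos ?_ hN
    nlinarith
  rcases le_or_gt A (4 * B) with h | h
  · have hB0 : 0 < B := by linarith
    have h1 := sub_le_mul_log_div hW0.le hB0
    have h2 : A * (Real.log A - Real.log B) ≤ A * (A / B - 1) := by
      rcases hA.eq_or_lt with rfl | hA
      · simp
      · have h := Real.log_le_sub_one_of_pos (div_pos hA hB0)
        rw [Real.log_div hA.ne' hB0.ne'] at h
        exact mul_le_mul_of_nonneg_left h hA.le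
    have h3 : A * (A / B - 1) - A + B = (A - B) ^ 2 / B := by
      field_simp; ring
    have h4 : (A - B) ^ 2 / B ≤ 5 * ((A - B) ^ 2 / (A + B)) := by
      rw [← mul_div_assoc, div_le_div_iff₀ hB0 hAB]
      nlinarith [sq_nonneg (A - B)]
    have h5 := mul_le_mul_of_nonneg_left h1 hN.le
    have h6 := mul_le_mul_of_nonneg_left h2 hs.le
    have h7 := mul_le_mul_of_nonneg_left h4 hs.le
    have h8 : 0 ≤ (A - B) ^ 2 / (A + B) := by positivity
    have h9 : s * (5 * ((A - B) ^ 2 / (A + B))) ≤ t * (5 * ((A - B) ^ 2 / (A + B))) :=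
      mul_le_mul_of_nonneg_right hst (by positivity)
    have h10 : (s * A + t * B) * Real.log W = (s + t) * (W * Real.log W) := by rw [hS]; ring
    have h11 : (s + t) * (W * Real.log B) = (s * A + t * B) * Real.log B := by rw [hS]; ring
    rw [h10]
    nlinarith
  · have hA0 : 0 < A := by linarith
    have hBW : B * Real.log B ≤ B * Real.log W := by
      rcases hB.eq_or_lt with h' | hB0
      · simp [← h']
      · refine mul_le_mul_of_nonneg_left (Real.log_le_log hB0 ?_) hB
        rw [hW, le_div_iff₀ hN]
        nlinarith
    have hAW : s * A * (Real.log A - Real.log W) ≤ t * A := by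
      have h1 := Real.log_le_sub_one_of_pos (div_pos hA0 hW0)
      rw [Real.log_div hA0.ne' hW0.ne'] at h1
      have h2 : A / W ≤ (s + t) / s := by
        rw [div_le_div_iff₀ hW0 hs, ← hS]
        nlinarith
      have h3 : s * A * (Real.log A - Real.log W) ≤ s * A * ((s + t) / s - 1) :=
        mul_le_mul_of_nonneg_left (by linarith) (by positivity)
      have h4 : s * A * ((s + t) / s - 1) = t * A := by field_simp; ring
      linarith
    have hfin : A ≤ 5 * ((A - B) ^ 2 / (A + B)) := by
      rw [← mul_div_assoc, le_div_iff₀ hAB]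
      nlinarith
    have := mul_le_mul_of_nonneg_left hfin ht.le
    have := mul_le_mul_of_nonneg_left hBW ht.le
    linarith

/-- A logarithmic Sobolev inequality for the two-point space. -/
theorem two_point_entropy_le {s t A B : ℝ} (hs : 0 < s) (ht : 0 < t) (hA : 0 ≤ A)
    (hB : 0 ≤ B) (hAB : 0 < A + B) :
    s * A * Real.log A + t * B * Real.log B -
      (s * A + t * B) * Real.log ((s * A + t * B) / (s + t)) ≤
        5 * (max s t * ((A - B) ^ 2 / (A + B))) := by
  rcases le_total s t with h | h
  · rw [max_eq_right h]
    linarith [two_point_entropy_le_aux hs h hA hB hAB]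
  · rw [max_eq_left h]
    have := two_point_entropy_le_aux ht h hB hA (by linarith)
    rw [add_comm (t * B), add_comm t s, add_comm B A, ← neg_sub A B, neg_sq] at this
    linarith

/-! ### Logarithmic Sobolev inequality -/

/-- The logarithmic Sobolev inequality for the exchange of steps of nonnegative lattice paths. -/
theorem entropy_le_swapEnergy (m : ℕ) (a : ℤ) (f : (Fin m → ℤˣ) → ℝ) :
    ∑ x ∈ pathsFrom m a, f x ^ 2 * Real.log (f x ^ 2) -
      (∑ x ∈ pathsFrom m a, f x ^ 2) * Real.log ((∑ x ∈ pathsFrom m a, f x ^ 2) / numPaths m a) ≤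
        10 * swapEnergy m a f := by
  induction m generalizing a with
  | zero =>
    have := swapEnergy_nonneg 0 a f
    rw [numPaths_zero, pathsFrom_zero]
    split_ifs <;> simp [this]
  | succ m ih =>
    rcases lt_or_ge a 0 with ha | ha
    · simp [pathsFrom_of_neg ha, swapEnergy]
    rw [sum_pathsFrom_succ ha, sum_pathsFrom_succ ha, numPaths_succ ha]
    have i₁ := ih (a + 1) (fun x => f (Fin.cons 1 x))
    have i₂ := ih (a - 1) (fun x => f (Fin.cons (-1) x))
    have hE := le_swapEnergy_succ ha f
    have hX := flipEnergy_nonneg m a (fun x => f (Fin.cons 1 x)) (fun x => f (Fin.cons (-1) x))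
    have hU0 : 0 ≤ ∑ x ∈ pathsFrom m (a + 1), f (Fin.cons 1 x) ^ 2 :=
      Finset.sum_nonneg fun _ _ => sq_nonneg _
    have hD0 : 0 ≤ ∑ x ∈ pathsFrom m (a - 1), f (Fin.cons (-1) x) ^ 2 :=
      Finset.sum_nonneg fun _ _ => sq_nonneg _
    have hC := sq_sub_le_flipEnergy (m := m) (b := a) (fun x => f (Fin.cons 1 x))
      (fun x => f (Fin.cons (-1) x))
      (A := (∑ x ∈ pathsFrom m (a + 1), f (Fin.cons 1 x) ^ 2) / numPaths m (a + 1))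
      (B := (∑ x ∈ pathsFrom m (a - 1), f (Fin.cons (-1) x) ^ 2) / numPaths m (a - 1))
    have hU : (numPaths m (a + 1) : ℝ) = 0 → ∑ x ∈ pathsFrom m (a + 1), f (Fin.cons 1 x) ^ 2 = 0 :=
      fun h => sum_eq_zero_of_numPaths_eq_zero h _
    have hD : (numPaths m (a - 1) : ℝ) = 0 →
        ∑ x ∈ pathsFrom m (a - 1), f (Fin.cons (-1) x) ^ 2 = 0 :=
      fun h => sum_eq_zero_of_numPaths_eq_zero h _
    push_cast
    -- By the chain rule for entropy only the two-point entropy remains; the constant is `10 = 5 *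
    -- 2`, from the two-point bound and the coupling bound.
    suffices h : ∀ S T s t X : ℝ, 0 ≤ S → 0 ≤ T → 0 ≤ s → 0 ≤ t → (s = 0 → S = 0) → (t = 0 → T = 0) →
        0 ≤ X → (0 < s → 0 < t → 0 < S / s + T / t → S = s * (S / s) → T = t * (T / t) →
          max s t * ((S / s - T / t) ^ 2 / (S / s + T / t)) ≤ 2 * X) →
        S * Real.log (S / s) + T * Real.log (T / t) - (S + T) * Real.log ((S + T) / (s + t)) ≤
          10 * X by
      have := h _ _ _ _ _ hU0 hD0 (Nat.cast_nonneg _) (Nat.cast_nonneg _) hU hD hX hC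
      linarith
    intro S T s t X hS hT hs ht hS0 hT0 hX hC
    rcases hs.eq_or_lt with h | hs
    · simp [← h, hS0 h.symm, hX]
    rcases ht.eq_or_lt with h | ht
    · simp [← h, hT0 h.symm, hX]
    have hA : 0 ≤ S / s := by positivity
    have hB : 0 ≤ T / t := by positivity
    have eS : s * (S / s) = S := mul_div_cancel₀ _ hs.ne'
    have eT : t * (T / t) = T := mul_div_cancel₀ _ ht.ne'
    rcases (add_nonneg hA hB).eq_or_lt with h | hAB
    · have hA' : S / s = 0 := by linarith
      have hB' : T / t = 0 := by linarith
      rw [hA', mul_zero] at eS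
      rw [hB', mul_zero] at eT
      simp [← eS, ← eT, hX]
    have h1 := hC hs ht hAB eS.symm eT.symm
    have h2 := two_point_entropy_le hs ht hA hB hAB
    rw [eS, eT] at h2
    linarith

/-! ### The walk on Dyck paths and its one-step decay -/

theorem mem_pathsFrom_zero_iff {n : ℕ} {x : Fin (2 * n) → ℤˣ} :
    x ∈ pathsFrom (2 * n) 0 ↔ IsDyckPath n x := by
  simp [mem_pathsFrom, IsDyckPath]

theorem numPaths_two_mul_zero (n : ℕ) : numPaths (2 * n) 0 = Fintype.card (DyckPath n) :=
  (Fintype.card_of_subtype _ fun _ => mem_pathsFrom_zero_iff).symm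

theorem sum_pathsFrom_zero {n : ℕ} (g : (Fin (2 * n) → ℤˣ) → ℝ) :
    ∑ x ∈ pathsFrom (2 * n) 0, g x = ∑ x : DyckPath n, g x.1 :=
  Finset.sum_subtype _ (fun _ => mem_pathsFrom_zero_iff) g

theorem dyckMove_dyckMove {n : ℕ} (x : DyckPath n) (i j : Fin (2 * n)) :
    dyckMove (dyckMove x i j) i j = x := by
  by_cases h : IsDyckPath n (fun k => x.1 (Equiv.swap i j k))
  · have e : dyckMove x i j = ⟨_, h⟩ := dif_pos h
    have h' : IsDyckPath n fun k => (dyckMove x i j).1 (Equiv.swap i j k) := by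
      rw [e]
      simpa using x.2
    apply Subtype.ext
    rw [dyckMove, dif_pos h']
    simp [e]
  · have e : dyckMove x i j = x := dif_neg h
    rw [e, e]

theorem dyckMove_of_eq {n : ℕ} (x : DyckPath n) {i j : Fin (2 * n)} (h : x.1 i = x.1 j) :
    dyckMove x i j = x := by
  have e : (fun k => x.1 (Equiv.swap i j k)) = x.1 := by
    funext k
    rw [Equiv.swap_apply_def]
    split_ifs with h1 h2
    · rw [h1, h]
    · rw [h2, h]
    · rfl
  unfold dyckMove
  split_ifs
  · exact Subtype.ext e
  · rfl

theorem sum_comp_dyckMove {n : ℕ} (i j : Fin (2 * n)) (f : DyckPath n → ℝ) :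
    ∑ x, f (dyckMove x i j) = ∑ x, f x :=
  Equiv.sum_comp (Function.Involutive.toPerm (fun x => dyckMove x i j)
    fun x => dyckMove_dyckMove x i j) f

theorem dyckWalk_comm {n : ℕ} (x y : DyckPath n) : dyckWalk n x y = dyckWalk n y x := by
  unfold dyckWalk
  congr 3
  ext p
  simp only [Finset.mem_filter, Finset.mem_univ, true_and]
  constructor <;> rintro rfl <;> exact dyckMove_dyckMove _ _ _

theorem dyckWalk_mulVec {n : ℕ} (f : DyckPath n → ℝ) (x : DyckPath n) :
    (dyckWalk n).mulVec f x =
      (∑ p : Fin (2 * n) × Fin (2 * n), f (dyckMove x p.1 p.2)) / (2 * n : ℝ) ^ 2 := by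
  simp only [Matrix.mulVec, dotProduct, dyckWalk, div_mul_eq_mul_div]
  rw [← Finset.sum_div]
  congr 1
  rw [← Finset.sum_fiberwise Finset.univ (fun p : Fin (2 * n) × Fin (2 * n) => dyckMove x p.1 p.2)]
  refine Finset.sum_congr rfl fun y _ => ?_
  rw [Finset.sum_congr rfl (g := fun _ => f y) fun p hp => by rw [(Finset.mem_filter.mp hp).2],
    Finset.sum_const, nsmul_eq_mul]

/-- The sum, over the Dyck paths and the moves, of the squared change of `f`. -/
noncomputable def dyckEnergy {n : ℕ} (f : DyckPath n → ℝ) : ℝ :=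
  ∑ x, ∑ p : Fin (2 * n) × Fin (2 * n), (f x - f (dyckMove x p.1 p.2)) ^ 2

theorem swapEnergy_eq_dyckEnergy {n : ℕ} (f : (Fin (2 * n) → ℤˣ) → ℝ) :
    swapEnergy (2 * n) 0 f = dyckEnergy fun x : DyckPath n => f x.1 := by
  rw [swapEnergy, sum_pathsFrom_zero, dyckEnergy]
  refine Finset.sum_congr rfl fun x _ => ?_
  rw [Fintype.sum_prod_type]
  refine Finset.sum_congr rfl fun i _ => Finset.sum_congr rfl fun j _ => ?_
  simp only [mem_pathsFrom_zero_iff]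
  unfold dyckMove
  split_ifs <;> simp

/-- The logarithmic Sobolev inequality for the random transposition walk on Dyck paths. -/
theorem entropy_le_dyckEnergy {n : ℕ} (f : DyckPath n → ℝ) :
    ∑ x, f x ^ 2 * Real.log (f x ^ 2) -
      (∑ x, f x ^ 2) * Real.log ((∑ x, f x ^ 2) / Fintype.card (DyckPath n)) ≤
        10 * dyckEnergy f := by
  have h := entropy_le_swapEnergy (2 * n) 0 fun x => if h : IsDyckPath n x then f ⟨x, h⟩ else 0
  rw [sum_pathsFrom_zero, sum_pathsFrom_zero, swapEnergy_eq_dyckEnergy, numPaths_two_mul_zero] at h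
  have e : ∀ x : DyckPath n, (if h : IsDyckPath n x.1 then f ⟨x.1, h⟩ else 0) = f x :=
    fun x => dif_pos x.2
  simpa only [e] using h

theorem sum_steps_eq_zero {n : ℕ} (x : DyckPath n) : ∑ i, ((x.1 i : ℤ) : ℝ) = 0 := by
  have h := x.2.1
  rw [pathHeight, Finset.filter_true_of_mem fun i _ => i.isLt] at h
  exact_mod_cast h

/-- The Cauchy-Schwarz inequality for the moves that exchange different steps, which are exactly
half of all moves. -/
theorem sq_sum_dyckMove_sub_le {n : ℕ} (f : DyckPath n → ℝ) (x : DyckPath n) :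
    (∑ p : Fin (2 * n) × Fin (2 * n), f (dyckMove x p.1 p.2) - (2 * n : ℝ) ^ 2 / 2 * f x) ^ 2 ≤
      (2 * n : ℝ) ^ 2 / 2 * (∑ p : Fin (2 * n) × Fin (2 * n), f (dyckMove x p.1 p.2) ^ 2 -
        (2 * n : ℝ) ^ 2 / 2 * f x ^ 2) := by
  -- The indicator that the two steps differ; its total is half of all pairs because the steps sum
  -- to `0`.
  set w : Fin (2 * n) × Fin (2 * n) → ℝ := fun p =>
    (1 - ((x.1 p.1 : ℤ) : ℝ) * ((x.1 p.2 : ℤ) : ℝ)) / 2 with hw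
  have hw' : ∀ p, w p = 0 ∧ dyckMove x p.1 p.2 = x ∨ w p = 1 := by
    intro p
    have hx := dyckMove_of_eq x (i := p.1) (j := p.2)
    rcases Int.units_eq_one_or (x.1 p.1) with h1 | h1 <;>
      rcases Int.units_eq_one_or (x.1 p.2) with h2 | h2
    · exact Or.inl ⟨by simp [hw, h1, h2], hx (h1.trans h2.symm)⟩
    · exact Or.inr (by simp [hw, h1, h2])
    · exact Or.inr (by simp [hw, h1, h2])
    · exact Or.inl ⟨by simp [hw, h1, h2], hx (h1.trans h2.symm)⟩
  have hcard : ∑ _p : Fin (2 * n) × Fin (2 * n), (1 : ℝ) = (2 * n : ℝ) ^ 2 := by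
    simp [sq]
  have hsum : ∑ p, w p = (2 * n : ℝ) ^ 2 / 2 := by
    rw [hw, ← Finset.sum_div, Finset.sum_sub_distrib, hcard, Fintype.sum_prod_type]
    simp [← Finset.mul_sum, sum_steps_eq_zero]
  have hg : ∀ g : DyckPath n → ℝ, ∑ p, w p * g (dyckMove x p.1 p.2) =
      ∑ p : Fin (2 * n) × Fin (2 * n), g (dyckMove x p.1 p.2) - (2 * n : ℝ) ^ 2 / 2 * g x := by
    intro g
    have e : ∀ p, w p * g (dyckMove x p.1 p.2) = g (dyckMove x p.1 p.2) - (1 - w p) * g x := by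
      intro p
      rcases hw' p with ⟨h, h'⟩ | h
      · rw [h, h']; ring
      · rw [h]; ring
    rw [Finset.sum_congr rfl fun p _ => e p, Finset.sum_sub_distrib, ← Finset.sum_mul,
      Finset.sum_sub_distrib, hcard, hsum]
    ring
  have hww : ∀ p, w p * w p = w p := by
    intro p
    rcases hw' p with ⟨h, -⟩ | h <;> simp [h]
  have cs := Finset.sum_mul_sq_le_sq_mul_sq Finset.univ w fun p => w p * f (dyckMove x p.1 p.2)
  simp only [mul_pow, sq (w _), ← mul_assoc, hww] at cs
  rwa [hsum, hg f, hg fun y => f y ^ 2] at cs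

/-- The decay of the second moment in one step of the walk. -/
theorem sum_sq_dyckWalk_mulVec_le {n : ℕ} (hn : 1 ≤ n) (f : DyckPath n → ℝ) :
    ∑ x, (dyckWalk n).mulVec f x ^ 2 ≤ ∑ x, f x ^ 2 - dyckEnergy f / (2 * (2 * n : ℝ) ^ 2) := by
  have hc : 0 < (2 * n : ℝ) ^ 2 := by positivity
  simp only [dyckWalk_mulVec, div_pow]
  rw [← Finset.sum_div]
  have hcard : ∑ _p : Fin (2 * n) × Fin (2 * n), (1 : ℝ) = (2 * n : ℝ) ^ 2 := by
    simp [sq]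
  have h2 : ∑ x, ∑ p : Fin (2 * n) × Fin (2 * n), f (dyckMove x p.1 p.2) ^ 2 =
      (2 * n : ℝ) ^ 2 * ∑ x, f x ^ 2 := by
    rw [Finset.sum_comm, ← hcard, Finset.sum_mul]
    refine Finset.sum_congr rfl fun p _ => ?_
    rw [one_mul]
    exact sum_comp_dyckMove p.1 p.2 fun y => f y ^ 2
  have hE : dyckEnergy f = 2 * (2 * n : ℝ) ^ 2 * ∑ x, f x ^ 2 -
      2 * ∑ x, f x * ∑ p : Fin (2 * n) × Fin (2 * n), f (dyckMove x p.1 p.2) := by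
    have e : ∀ x, ∑ p : Fin (2 * n) × Fin (2 * n), (f x - f (dyckMove x p.1 p.2)) ^ 2 =
        (2 * n : ℝ) ^ 2 * f x ^ 2 -
          2 * (f x * ∑ p : Fin (2 * n) × Fin (2 * n), f (dyckMove x p.1 p.2)) +
          ∑ p : Fin (2 * n) × Fin (2 * n), f (dyckMove x p.1 p.2) ^ 2 := by
      intro x
      rw [← hcard, Finset.sum_mul, Finset.mul_sum, Finset.mul_sum, ← Finset.sum_sub_distrib,
        ← Finset.sum_add_distrib]
      exact Finset.sum_congr rfl fun p _ => by ring
    rw [dyckEnergy, Finset.sum_congr rfl fun x _ => e x, Finset.sum_add_distrib,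
      Finset.sum_sub_distrib, h2, ← Finset.mul_sum, ← Finset.mul_sum]
    ring
  -- With `P = (1 + Q) / 2`, this is the contraction of `Q` in `L₂`, which amounts to `‖P f‖ ^ 2 ≤
  -- ⟨f, P f⟩`.
  have hA := Finset.sum_le_sum fun x (_ : x ∈ Finset.univ) => sq_sum_dyckMove_sub_le f x
  rw [← Finset.mul_sum, Finset.sum_sub_distrib, h2, ← Finset.mul_sum] at hA
  have hA' : ∑ x, (∑ p : Fin (2 * n) × Fin (2 * n), f (dyckMove x p.1 p.2) -
      (2 * n : ℝ) ^ 2 / 2 * f x) ^ 2 =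
      ∑ x, (∑ p : Fin (2 * n) × Fin (2 * n), f (dyckMove x p.1 p.2)) ^ 2 -
      (2 * n : ℝ) ^ 2 * ∑ x, f x * ∑ p : Fin (2 * n) × Fin (2 * n), f (dyckMove x p.1 p.2) +
      ((2 * n : ℝ) ^ 2 / 2) ^ 2 * ∑ x, f x ^ 2 := by
    rw [Finset.mul_sum, Finset.mul_sum, ← Finset.sum_sub_distrib, ← Finset.sum_add_distrib]
    exact Finset.sum_congr rfl fun x _ => by ring
  rw [hA'] at hA
  rw [hE]
  generalize (2 * n : ℝ) ^ 2 = c at *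
  have e : ∀ F D : ℝ, F - (2 * c * F - 2 * D) / (2 * c) = D / c := by
    intro F D
    field_simp
    ring
  rw [e, div_le_div_iff₀ (by positivity) hc]
  nlinarith

/-! ### Decay of the second moment -/

/-- The entropy of the square of a probability density is controlled from below by its
second moment. -/
theorem mul_log_le_entropy_sq {Ω : Type*} [Fintype Ω] [Nonempty Ω] {g : Ω → ℝ} (h0 : ∀ y, 0 ≤ g y)
    (h1 : ∑ y, g y = 1) (hV : 0 < ∑ y, g y ^ 2) :
    (∑ y, g y ^ 2) * Real.log (Fintype.card Ω * ∑ y, g y ^ 2) ≤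
      ∑ y, g y ^ 2 * Real.log (g y ^ 2) -
        (∑ y, g y ^ 2) * Real.log ((∑ y, g y ^ 2) / Fintype.card Ω) := by
  have hN : (0 : ℝ) < Fintype.card Ω := by exact_mod_cast Fintype.card_pos
  set V := ∑ y, g y ^ 2 with hVdef
  have key : 0 ≤ ∑ y, (g y ^ 2 * Real.log (g y ^ 2) - g y ^ 2 * (2 * Real.log V)) := by
    have e : ∑ y, 2 * (g y * (g y - V)) = 0 := by
      rw [← Finset.mul_sum]
      simp only [mul_sub]
      rw [Finset.sum_sub_distrib, ← Finset.sum_mul, h1, hVdef]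
      simp [sq]
    rw [← e]
    refine Finset.sum_le_sum fun y _ => ?_
    have := mul_le_mul_of_nonneg_left (sub_le_mul_log_div (h0 y) hV) (h0 y)
    rw [Real.log_pow]
    push_cast
    nlinarith
  rw [Finset.sum_sub_distrib, ← Finset.sum_mul, ← hVdef] at key
  rw [Real.log_mul hN.ne' hV.ne', Real.log_div hV.ne' hN.ne']
  linarith

theorem one_le_card_mul_sum_sq {Ω : Type*} [Fintype Ω] {g : Ω → ℝ} (h1 : ∑ y, g y = 1) :
    1 ≤ Fintype.card Ω * ∑ y, g y ^ 2 := by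
  have := sq_sum_le_card_mul_sum_sq (s := Finset.univ) (f := g)
  rwa [h1, one_pow, Finset.card_univ] at this

/-- The energy dominates `V * log (N * V)`, so `V' ≤ V * (1 - δ * log (N * V))`; taking logarithms
turns this into a linear contraction. Here `80 = 10 * 2 * 2 ^ 2`. -/
theorem log_card_mul_sum_sq_mulVec_le {n : ℕ} (hn : 1 ≤ n) {g : DyckPath n → ℝ}
    (h0 : ∀ y, 0 ≤ g y) (h1 : ∑ y, g y = 1) (h1' : ∑ y, (dyckWalk n).mulVec g y = 1) :
    Real.log (Fintype.card (DyckPath n) * ∑ y, (dyckWalk n).mulVec g y ^ 2) ≤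
      (1 - 1 / (80 * (n : ℝ) ^ 2)) * Real.log (Fintype.card (DyckPath n) * ∑ y, g y ^ 2) := by
  have hv := one_le_card_mul_sum_sq h1
  have hv' := one_le_card_mul_sum_sq h1'
  have hne : Nonempty (DyckPath n) := by
    by_contra h
    rw [not_nonempty_iff] at h
    simp at h1
  have hN : (0 : ℝ) < Fintype.card (DyckPath n) := by exact_mod_cast Fintype.card_pos
  have hV : 0 < ∑ y, g y ^ 2 := by
    by_contra h
    nlinarith
  have hn' : (0 : ℝ) < n := by exact_mod_cast hn
  have hE := (mul_log_le_entropy_sq h0 h1 hV).trans (entropy_le_dyckEnergy g)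
  have hD := sum_sq_dyckWalk_mulVec_le hn g
  set V := ∑ y, g y ^ 2
  set V' := ∑ y, (dyckWalk n).mulVec g y ^ 2
  set N : ℝ := (Fintype.card (DyckPath n) : ℝ)
  set δ := 1 / (80 * (n : ℝ) ^ 2) with hδ
  have h2 : V' ≤ V * (1 - δ * Real.log (N * V)) := by
    have e : dyckEnergy g / (2 * (2 * n : ℝ) ^ 2) = δ * (10 * dyckEnergy g) := by
      rw [hδ]
      field_simp
      ring
    have hδ0 : 0 ≤ δ := by positivity
    have := mul_le_mul_of_nonneg_left hE hδ0
    rw [e] at hD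
    nlinarith
  have h3 : N * V' ≤ N * V * (1 - δ * Real.log (N * V)) := by
    have := mul_le_mul_of_nonneg_left h2 hN.le
    linarith
  have h4 : 0 < 1 - δ * Real.log (N * V) := by
    by_contra h
    have : N * V * (1 - δ * Real.log (N * V)) ≤ 0 :=
      mul_nonpos_of_nonneg_of_nonpos (by linarith) (not_lt.mp h)
    linarith
  have h5 := Real.log_le_log (by linarith) h3
  rw [Real.log_mul (by linarith) h4.ne'] at h5
  have h6 := Real.log_le_sub_one_of_pos h4
  linarith

theorem dyckWalk_pow_succ_row {n : ℕ} (t : ℕ) (x : DyckPath n) :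
    (dyckWalk n ^ (t + 1)) x = (dyckWalk n).mulVec ((dyckWalk n ^ t) x) := by
  funext y
  rw [pow_succ, Matrix.mul_apply, Matrix.mulVec, dotProduct]
  exact Finset.sum_congr rfl fun z _ => by rw [dyckWalk_comm z y, mul_comm]

theorem sum_dyckWalk_mulVec {n : ℕ} (hn : 1 ≤ n) (f : DyckPath n → ℝ) :
    ∑ y, (dyckWalk n).mulVec f y = ∑ y, f y := by
  have hn' : (0 : ℝ) < n := by exact_mod_cast hn
  simp only [dyckWalk_mulVec]
  rw [← Finset.sum_div, Finset.sum_comm,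
    Finset.sum_congr rfl fun p _ => sum_comp_dyckMove p.1 p.2 f, Finset.sum_const,
    Finset.card_univ, Fintype.card_prod, Fintype.card_fin]
  field_simp
  simp only [nsmul_eq_mul]
  push_cast
  ring

theorem dyckWalk_pow_row_nonneg {n : ℕ} (t : ℕ) (x y : DyckPath n) : 0 ≤ (dyckWalk n ^ t) x y := by
  induction t generalizing y with
  | zero => rw [pow_zero, Matrix.one_apply]; split_ifs <;> norm_num
  | succ t ih =>
    rw [dyckWalk_pow_succ_row, dyckWalk_mulVec]
    exact div_nonneg (Finset.sum_nonneg fun p _ => ih _) (by positivity)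

theorem sum_dyckWalk_pow_row {n : ℕ} (hn : 1 ≤ n) (t : ℕ) (x : DyckPath n) :
    ∑ y, (dyckWalk n ^ t) x y = 1 := by
  induction t with
  | zero => simp [Matrix.one_apply]
  | succ t ih => rw [dyckWalk_pow_succ_row, sum_dyckWalk_mulVec hn, ih]

theorem log_card_mul_sum_sq_pow_le {n : ℕ} (hn : 1 ≤ n) (t : ℕ) (x : DyckPath n) :
    Real.log (Fintype.card (DyckPath n) * ∑ y, (dyckWalk n ^ t) x y ^ 2) ≤
      Real.exp (-(t / (80 * (n : ℝ) ^ 2))) * Real.log (Fintype.card (DyckPath n)) := by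
  have hn' : (1 : ℝ) ≤ n := by exact_mod_cast hn
  induction t with
  | zero => simp [Matrix.one_apply]
  | succ t ih =>
    have h1 := sum_dyckWalk_pow_row hn t x
    have h := log_card_mul_sum_sq_mulVec_le hn (dyckWalk_pow_row_nonneg t x) h1
      ((sum_dyckWalk_mulVec hn _).trans h1)
    rw [← dyckWalk_pow_succ_row] at h
    refine h.trans ?_
    have h0 := Real.log_nonneg (one_le_card_mul_sum_sq h1)
    have h2 : 1 - 1 / (80 * (n : ℝ) ^ 2) ≤ Real.exp (-(1 / (80 * (n : ℝ) ^ 2))) := by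
      linarith [Real.add_one_le_exp (-(1 / (80 * (n : ℝ) ^ 2)))]
    refine (mul_le_mul h2 ih h0 (Real.exp_pos _).le).trans (le_of_eq ?_)
    rw [← mul_assoc, ← Real.exp_add]
    push_cast
    congr 2
    ring

/-! ### Distances and mixing times -/

theorem l2Dist_uniformDist {Ω : Type} [Fintype Ω] [Nonempty Ω] {g : Ω → ℝ} (h1 : ∑ y, g y = 1) :
    l2Dist g (uniformDist Ω) = √(Fintype.card Ω * ∑ y, g y ^ 2 - 1) := by
  have hN : (0 : ℝ) < Fintype.card Ω := by exact_mod_cast Fintype.card_pos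
  unfold l2Dist uniformDist
  congr 1
  have e : ∀ y, 1 / (Fintype.card Ω : ℝ) * (g y / (1 / Fintype.card Ω) - 1) ^ 2 =
      Fintype.card Ω * g y ^ 2 - 2 * g y + 1 / Fintype.card Ω := by
    intro y
    field_simp
    ring
  rw [Finset.sum_congr rfl fun y _ => e y, Finset.sum_add_distrib, Finset.sum_sub_distrib,
    ← Finset.mul_sum, ← Finset.mul_sum, h1, Finset.sum_const, Finset.card_univ, nsmul_eq_mul,
    mul_one_div_cancel hN.ne']
  ring

theorem tvDist_le_l2Dist {Ω : Type} [Fintype Ω] {μ π : Ω → ℝ} (h0 : ∀ y, 0 < π y)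
    (h1 : ∑ y, π y = 1) : tvDist μ π ≤ l2Dist μ π := by
  unfold tvDist l2Dist
  have hnn : 0 ≤ ∑ y, |μ y - π y| := Finset.sum_nonneg fun _ _ => abs_nonneg _
  suffices h : ∑ y, |μ y - π y| ≤ √(∑ y, π y * (μ y / π y - 1) ^ 2) by linarith
  refine Real.le_sqrt_of_sq_le ?_
  have cs := Finset.sum_mul_sq_le_sq_mul_sq Finset.univ (fun y => √(π y))
    fun y => √(π y) * |μ y / π y - 1|
  simp only [mul_pow, Real.sq_sqrt (h0 _).le, sq_abs, h1, one_mul, ← mul_assoc,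
    Real.mul_self_sqrt (h0 _).le] at cs
  refine le_trans (le_of_eq ?_) cs
  congr 1
  refine Finset.sum_congr rfl fun y _ => ?_
  have hy := h0 y
  have e : μ y - π y = π y * (μ y / π y - 1) := by field_simp
  rw [e, abs_mul, abs_of_pos hy]

theorem log_card_dyckPath_le (n : ℕ) :
    Real.log (Fintype.card (DyckPath n)) ≤ n * Real.log 4 := by
  have h : Fintype.card (DyckPath n) ≤ 4 ^ n := by
    refine (Fintype.card_subtype_le _).trans (le_of_eq ?_)
    rw [Fintype.card_fun, Fintype.card_fin, Fintype.card_units_int, pow_mul]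
    norm_num
  rcases Nat.eq_zero_or_pos (Fintype.card (DyckPath n)) with h0 | h0
  · rw [h0, Nat.cast_zero, Real.log_zero]
    positivity
  · rw [← Real.log_pow]
    exact Real.log_le_log (by exact_mod_cast h0) (by exact_mod_cast h)

theorem log_card_dyckPath_one : Real.log (Fintype.card (DyckPath 1)) = 0 := by
  have h : Fintype.card (DyckPath 1) = 1 := by decide
  rw [h, Nat.cast_one, Real.log_one]

/-- After order `n² log n` steps the factor of decay beats the initial value. -/
theorem exists_exp_mul_log_card_le {η : ℝ} (hη : 0 < η) :
    ∃ C : ℝ, 0 < C ∧ ∀ n : ℕ, 1 ≤ n → ∀ t : ℕ, ⌊C * (n : ℝ) ^ 2 * Real.log n⌋₊ ≤ t →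
      Real.exp (-(t / (80 * (n : ℝ) ^ 2))) * Real.log (Fintype.card (DyckPath n)) ≤ η := by
  set K := |Real.log (Real.log 4 / η)| with hK
  have hK0 : 0 ≤ K := abs_nonneg _
  -- Since `log n ≥ 1 / 2` for `n ≥ 2`, the surplus `2` over `80` absorbs the rounding and `160 * K`
  -- yields `80 * K`.
  refine ⟨82 + 160 * K, by positivity, fun n hn t ht => ?_⟩
  -- For `n = 1` the time bound is `0`, but there is only one Dyck path.
  rcases hn.eq_or_lt with rfl | hn
  · rw [log_card_dyckPath_one, mul_zero]
    exact hη.le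
  have hn2 : (2 : ℝ) ≤ n := by exact_mod_cast hn
  have hlog : 1 / 2 ≤ Real.log n := by
    have := Real.log_le_log two_pos hn2
    linarith [Real.log_two_gt_d9]
  have hl4 : 0 < Real.log 4 := Real.log_pos (by norm_num)
  have ht' : (82 + 160 * K) * (n : ℝ) ^ 2 * Real.log n - 1 ≤ t := by
    have h1 := Nat.lt_floor_add_one ((82 + 160 * K) * (n : ℝ) ^ 2 * Real.log n)
    have h2 : ((⌊(82 + 160 * K) * (n : ℝ) ^ 2 * Real.log n⌋₊ : ℕ) : ℝ) ≤ t := by exact_mod_cast ht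
    linarith
  have h1 : Real.log n + K ≤ t / (80 * (n : ℝ) ^ 2) := by
    rw [le_div_iff₀ (by positivity)]
    have h2 : 1 ≤ (n : ℝ) ^ 2 := by nlinarith
    have h3 : (n : ℝ) ^ 2 * (1 / 2) ≤ (n : ℝ) ^ 2 * Real.log n :=
      mul_le_mul_of_nonneg_left hlog (by positivity)
    have h4 := mul_le_mul_of_nonneg_left h3 hK0
    nlinarith
  calc _ ≤ Real.exp (-(Real.log n + K)) * (n * Real.log 4) :=
        mul_le_mul (Real.exp_le_exp.mpr (by linarith)) (log_card_dyckPath_le n)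
          (Real.log_natCast_nonneg _) (Real.exp_pos _).le
    _ ≤ Real.exp (-(Real.log n + Real.log (Real.log 4 / η))) * (n * Real.log 4) := by
        refine mul_le_mul_of_nonneg_right (Real.exp_le_exp.mpr ?_) (by positivity)
        linarith [le_abs_self (Real.log (Real.log 4 / η))]
    _ = η := by
        rw [neg_add, Real.exp_add, Real.exp_neg, Real.exp_neg, Real.exp_log (by linarith),
          Real.exp_log (by positivity)]
        field_simp

theorem mainTheorem1 (ε : ℝ) (hε : 0 < ε) :
    ∃ C : ℝ, 0 < C ∧ ∀ n : ℕ, 1 ≤ n →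
      mixingTime l2Dist (dyckWalk n) (uniformDist (DyckPath n)) ε
          ≤ (⌊C * (n : ℝ) ^ 2 * Real.log n⌋₊ : ℕ∞) ∧
      mixingTime tvDist (dyckWalk n) (uniformDist (DyckPath n)) ε
          ≤ (⌊C * (n : ℝ) ^ 2 * Real.log n⌋₊ : ℕ∞) := by
  have hη : 0 < Real.log (1 + ε ^ 2) := Real.log_pos (by nlinarith)
  obtain ⟨C, hC, h⟩ := exists_exp_mul_log_card_le hη
  refine ⟨C, hC, fun n hn => ?_⟩
  have hl2 : ∀ t : ℕ, ⌊C * (n : ℝ) ^ 2 * Real.log n⌋₊ ≤ t → ∀ x,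
      l2Dist ((dyckWalk n ^ t) x) (uniformDist (DyckPath n)) ≤ ε := by
    intro t ht x
    have : Nonempty (DyckPath n) := ⟨x⟩
    have h1 := sum_dyckWalk_pow_row hn t x
    rw [l2Dist_uniformDist h1]
    have h2 := (log_card_mul_sum_sq_pow_le hn t x).trans (h n hn t ht)
    have h3 := (Real.log_le_log_iff (by linarith [one_le_card_mul_sum_sq h1]) (by positivity)).mp h2
    exact Real.sqrt_le_iff.mpr ⟨hε.le, by linarith⟩
  refine ⟨iInf₂_le _ hl2, iInf₂_le _ fun t ht x => ?_⟩
  have : Nonempty (DyckPath n) := ⟨x⟩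
  have hN : (0 : ℝ) < Fintype.card (DyckPath n) := by exact_mod_cast Fintype.card_pos
  refine (tvDist_le_l2Dist (fun _ => ?_) ?_).trans (hl2 t ht x)
  · exact one_div_pos.mpr hN
  · simp only [uniformDist]
    rw [Finset.sum_const, Finset.card_univ, nsmul_eq_mul, mul_one_div_cancel hN.ne']
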